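/- Let $G$ be a topological group (not assumed Hausdorff). Write $\lambda_g(x)=gx$, and let $\mathrm{RUCB}(G)$ be the algebra of all bounded functions $f\colon G\to\mathbb R$ that are uniformly continuous with respect to the right uniformity of $G$, that is, for every $\epsilon>0$ there is a neighbourhood $U$ of the neutral element with $|f(x)-f(y)|<\epsilon$ whenever $xy^{-1}\in U$. A mean on $G$ is a positive unital linear form on $\mathrm{RUCB}(G)$; the set of means is denoted $\mathrm M(G)$. A mean $\nu$ is $G$-left-invariant if $\nu(f\circ\lambda_g)=\nu(f)$ for all $f\in\mathrm{RUCB}(G)$ and $g\in G$, and $G$ is amenable if such a mean exists. The convolution of $\mu,\nu\in\mathrm M(G)$ is the mean $(\mu\nu)(f)=\mu\bigl(g\mapsto\nu(f\circ\lambda_g)\bigr)$, with neutral element $f\mapsto f(e)$. For a subgroup $H\le G$ with the relative topology, a mean $\nu\in\mathrm M(H)$ is regarded as the mean $f\mapsto\nu(f|_H)$ on $G$. The Samuel compactification $\mathrm S(G)$ is the compact Hausdorff space of all unital ring homomorphisms $\xi\colon\mathrm{RUCB}(G)\to\mathbb R$ with the weak-$*$ topology, and $\eta\colon G\to\mathrm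 S(G)$ is given by $\eta(x)(f)=f(x)$. For $\mu\in\mathrm M(G)$, let $\hat\mu$ be the unique regular Borel probability measure on $\mathrm S(G)$ with $\int F\,d\hat\mu=\mu(F\circ\eta)$ for every continuous $F\colon\mathrm S(G)\to\mathbb R$. Let $n\ge 0$ and let $\{e\}=G_0\le G_1\le\dots\le G_n=G$ be a chain of subgroups each of which is amenable as a topological group with the relative topology. For each $i\in\{1,\dots,n\}$ let $\nu_i\in\mathrm M(G_i)$ be $G_i$-left-invariant, and put $\mu=\nu_n\cdots\nu_1\in\mathrm M(G)$. Let $d$ be a bounded, continuous, right-invariant pseudo-metric on $G$, and define $$\ell(G_0,\dots,G_n;d)=\Bigl(\sum_{i=0}^{n-1}\Bigl(\sup_{g\in G}\ \sup_{x,y\in G_{i+1}}\ \inf_{h\in G_i}d(gx,gyh)\Bigr)^2\Bigr)^{1/2}.$$ Then every $f\colon G\to\mathbb R$ with $|f(x)-f(y)|\le d(x,y)$ for all $x,y\in G$ belongs to $\mathrm{RUCB}(G)$, and for every such $f$ and every real $\epsilon>0$, $$\hat\mu\bigl(\{\xi\in\mathrm S(G):|\xi(f)-\mu(f)|\ge\epsilon\}\bigr)\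 \le\ 2\exp\left(-\frac{\epsilon^2}{2\,\ell(G_0,\dots,G_n;d)^2}\right),$$ where the right-hand side is read as $0$ if $\ell(G_0,\dots,G_n;d)=0$. -/

import Mathlib

open scoped BoundedContinuousFunction ENNReal Topology

namespace InvariantMeans

noncomputable section

section UniformlyContinuousFunctions

theorem uniformContinuous_iff {G : Type*} [Group G] [TopologicalSpace G] [IsTopologicalGroup G]
    (f : G → ℝ) :
    @UniformContinuous G ℝ (IsTopologicalGroup.rightUniformSpace G) _ f ↔
      ∀ ε > 0, ∃ U ∈ 𝓝 (1 : G), ∀ x y, y * x⁻¹ ∈ U → |f x - f y| < ε := by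
  let _ := IsTopologicalGroup.rightUniformSpace G
  have hb : (uniformity G).HasBasis (fun U => U ∈ 𝓝 (1 : G))
      (fun U => (fun p : G × G => p.2 * p.1⁻¹) ⁻¹' U) := by
    rw [uniformity_eq_comap_nhds_one']
    exact (𝓝 (1 : G)).basis_sets.comap _
  rw [hb.uniformContinuous_iff Metric.uniformity_basis_dist]
  simp [Real.dist_eq]

/-- `RUCB(G)`: the unital real Banach algebra of all bounded real-valued functions on the
topological group `G` that are uniformly continuous with respect to the right uniformity of `G`
(entourages `{(x, y) | y * x⁻¹ ∈ U}`, `U` a neighbourhood of `1`), with the supremum norm. -/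
def RUCB (G : Type*) [Group G] [TopologicalSpace G] [IsTopologicalGroup G] :
    Subalgebra ℝ (G →ᵇ ℝ) where
  carrier := {f | @UniformContinuous G ℝ (IsTopologicalGroup.rightUniformSpace G) _ f}
  mul_mem' {f g} hf hg := by
    refine (uniformContinuous_iff _).2 fun ε hε => ?_
    have hpos : 0 < ε / (‖f‖ + ‖g‖ + 1) := by positivity
    obtain ⟨U, hU, h⟩ := (uniformContinuous_iff _).1 hf _ hpos
    obtain ⟨V, hV, h'⟩ := (uniformContinuous_iff _).1 hg _ hpos
    refine ⟨U ∩ V, Filter.inter_mem hU hV, fun x y hxy => ?_⟩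
    have h1 := (h x y hxy.1).le
    have h2 := (h' x y hxy.2).le
    have e : f x * g x - f y * g y = f x * (g x - g y) + (f x - f y) * g y := by ring
    calc |f x * g x - f y * g y| ≤ |f x| * |g x - g y| + |f x - f y| * |g y| := by
          rw [e, ← abs_mul, ← abs_mul]; exact abs_add_le _ _
      _ ≤ ‖f‖ * (ε / (‖f‖ + ‖g‖ + 1)) + (ε / (‖f‖ + ‖g‖ + 1)) * ‖g‖ := by
          gcongr
          · exact f.norm_coe_le_norm x
          · exact g.norm_coe_le_norm y
      _ < (‖f‖ + ‖g‖ + 1) * (ε / (‖f‖ + ‖g‖ + 1)) := by linarith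
      _ = ε := by field_simp
  add_mem' {f g} hf hg := by
    let _ := IsTopologicalGroup.rightUniformSpace G
    exact UniformContinuous.add (f := f) (g := g) hf hg
  algebraMap_mem' r := by
    let _ := IsTopologicalGroup.rightUniformSpace G
    exact uniformContinuous_const (b := r)

variable {G : Type*} [Group G] [TopologicalSpace G] [IsTopologicalGroup G]

theorem RUCB.exists_nhds (f : RUCB G) {ε : ℝ} (hε : 0 < ε) :
    ∃ U ∈ 𝓝 (1 : G), ∀ x y, y * x⁻¹ ∈ U → |f.1 x - f.1 y| < ε :=
  (uniformContinuous_iff f.1).1 f.2 ε hε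

/-- A bounded right-uniformly continuous function as an element of `RUCB(G)`. -/
def RUCB.mk (f : G → ℝ) (hb : ∃ C, ∀ x, |f x| ≤ C)
    (hf : ∀ ε > 0, ∃ U ∈ 𝓝 (1 : G), ∀ x y, y * x⁻¹ ∈ U → |f x - f y| < ε) : RUCB G :=
  ⟨BoundedContinuousFunction.ofNormedAddCommGroup f
    (by
      let _ := IsTopologicalGroup.rightUniformSpace G
      exact ((uniformContinuous_iff f).2 hf).continuous) hb.choose hb.choose_spec,
    (uniformContinuous_iff f).2 hf⟩

instance : CoeFun (RUCB G) (fun _ => G → ℝ) := ⟨fun f => f.1⟩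

@[simp] theorem RUCB.mk_apply (f : G → ℝ) (hb hf) (x : G) : RUCB.mk f hb hf x = f x := rfl

@[ext] theorem RUCB.ext {f g : RUCB G} (h : ∀ x, f x = g x) : f = g :=
  Subtype.ext (BoundedContinuousFunction.ext h)

theorem RUCB.abs_le (f : RUCB G) (x : G) : |f x| ≤ ‖f‖ := f.1.norm_coe_le_norm x

/-- `f ∘ λ_g`, where `λ_g x = g * x`. -/
def leftTranslate (f : RUCB G) (g : G) : RUCB G :=
  RUCB.mk (fun x => f (g * x)) ⟨‖f‖, fun x => RUCB.abs_le f (g * x)⟩ (by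
    intro ε hε
    obtain ⟨U, hU, h⟩ := RUCB.exists_nhds f hε
    refine ⟨(fun z => g * z * g⁻¹) ⁻¹' U, ?_, fun x y hxy => h _ _ ?_⟩
    · have hc : Continuous fun z : G => g * z * g⁻¹ := by fun_prop
      exact hc.continuousAt.preimage_mem_nhds (by simpa using hU)
    · simpa [mul_assoc] using hxy)

@[simp] theorem leftTranslate_apply (f : RUCB G) (g x : G) :
    leftTranslate f g x = f (g * x) := rfl

/-- The restriction `f|_H` of `f ∈ RUCB(G)` to a subgroup `H` with its relative topology. -/
def restrict (H : Subgroup G) (f : RUCB G) : RUCB H :=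
  RUCB.mk (fun x => f (x : G)) ⟨‖f‖, fun x => RUCB.abs_le f x⟩ (by
    intro ε hε
    obtain ⟨U, hU, h⟩ := RUCB.exists_nhds f hε
    refine ⟨((↑) : H → G) ⁻¹' U, ?_, fun x y hxy => h _ _ (by simpa using hxy)⟩
    exact continuous_subtype_val.continuousAt.preimage_mem_nhds (by simpa using hU))

@[simp] theorem restrict_apply (H : Subgroup G) (f : RUCB G) (x : H) :
    restrict H f x = f (x : G) := rfl

theorem RUCB.isClosed : IsClosed (RUCB G : Set (G →ᵇ ℝ)) := by
  let _ := IsTopologicalGroup.rightUniformSpace G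
  refine isClosed_of_closure_subset fun f hf => ?_
  obtain ⟨u, hu, hlim⟩ := mem_closure_iff_seq_limit.1 hf
  exact (BoundedContinuousFunction.tendsto_iff_tendstoUniformly.1 hlim).uniformContinuous
    (Filter.Frequently.of_forall hu)

instance : CompleteSpace (RUCB G) := RUCB.isClosed.completeSpace_coe

end UniformlyContinuousFunctions

section Means

variable (G : Type*) [Group G] [TopologicalSpace G] [IsTopologicalGroup G]

/-- `M(G)`: the means on `G`, i.e. the positive unital linear forms on `RUCB(G)`. -/
structure Mean extends RUCB G →ₗ[ℝ] ℝ where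
  map_nonneg' : ∀ f : RUCB G, (∀ x, 0 ≤ f x) → 0 ≤ toFun f
  map_one' : toFun 1 = 1

variable {G}

namespace Mean

instance : FunLike (Mean G) (RUCB G) ℝ where
  coe μ := μ.toFun
  coe_injective μ ν h := by
    cases μ; cases ν; congr; exact DFunLike.coe_injective h

instance : LinearMapClass (Mean G) ℝ (RUCB G) ℝ where
  map_add μ := μ.map_add'
  map_smulₛₗ μ := μ.map_smul'

@[ext] theorem ext {μ ν : Mean G} (h : ∀ f, μ f = ν f) : μ = ν := DFunLike.ext _ _ h

theorem map_nonneg (μ : Mean G) {f : RUCB G} (h : ∀ x, 0 ≤ f x) : 0 ≤ μ f := μ.map_nonneg' f h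

theorem map_one (μ : Mean G) : μ 1 = 1 := μ.map_one'

theorem mono (μ : Mean G) {f g : RUCB G} (h : ∀ x, f x ≤ g x) : μ f ≤ μ g := by
  have h1 := μ.map_nonneg (f := g - f) fun x => sub_nonneg.2 (h x)
  have h2 : μ (g - f) = μ g - μ f := μ.toLinearMap.map_sub g f
  linarith

theorem abs_le (μ : Mean G) {f : RUCB G} {C : ℝ} (h : ∀ x, |f x| ≤ C) : |μ f| ≤ C := by
  have hC : μ (C • (1 : RUCB G)) = C := by rw [map_smul, μ.map_one]; simp
  have h1 : μ f ≤ μ (C • (1 : RUCB G)) := μ.mono fun x => by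
    have := (_root_.abs_le.1 (h x)).2
    simpa using this
  have h2 : μ (-f) ≤ μ (C • (1 : RUCB G)) := μ.mono fun x => by
    have := (_root_.abs_le.1 (h x)).1
    have h3 : -(f x) ≤ C := by linarith
    simpa using h3
  rw [show μ (-f) = -μ f from μ.toLinearMap.map_neg f] at h2
  rw [hC] at h1 h2
  exact _root_.abs_le.2 ⟨by linarith, h1⟩

/-- `(Φ_μ f)(g) = μ(f ∘ λ_g)`. -/
def convOp (μ : Mean G) (f : RUCB G) : RUCB G :=
  RUCB.mk (fun g => μ (leftTranslate f g))
    ⟨‖f‖, fun g => μ.abs_le fun x => RUCB.abs_le f (g * x)⟩ (by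
    intro ε hε
    obtain ⟨U, hU, h⟩ := RUCB.exists_nhds f (half_pos hε)
    refine ⟨U, hU, fun x y hxy => ?_⟩
    rw [← map_sub]
    refine lt_of_le_of_lt (μ.abs_le (C := ε / 2) fun z => ?_) (half_lt_self hε)
    exact (h (x * z) (y * z) (by simpa [mul_assoc] using hxy)).le)

@[simp] theorem convOp_apply (μ : Mean G) (f : RUCB G) (g : G) :
    μ.convOp f g = μ (leftTranslate f g) := rfl

/-- Convolution of means: `(μν)(f) = μ(Φ_ν f)`, with neutral element the evaluation at `1`. -/
instance : Monoid (Mean G) where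
  mul μ ν :=
    { toFun := fun f => μ (ν.convOp f)
      map_add' := fun f g => by
        rw [← map_add]; congr 1; ext x
        exact map_add ν (leftTranslate f x) (leftTranslate g x)
      map_smul' := fun c f => by
        rw [RingHom.id_apply, ← map_smul]; congr 1; ext x
        exact map_smul ν c (leftTranslate f x)
      map_nonneg' := fun f hf => μ.map_nonneg fun x => ν.map_nonneg fun y => hf (x * y)
      map_one' := by
        have h : ν.convOp 1 = 1 := by ext x; exact ν.map_one
        change μ (ν.convOp 1) = 1
        rw [h, μ.map_one] }
  one :=
    { toFun := fun f => f 1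
      map_add' := fun _ _ => rfl
      map_smul' := fun _ _ => rfl
      map_nonneg' := fun _ hf => hf 1
      map_one' := rfl }
  mul_assoc μ ν ρ := by
    ext f
    change μ (ρ.convOp f |> ν.convOp) = μ _
    congr 1; ext x
    change ν _ = ν _
    congr 1; ext y
    change ρ _ = ρ _
    congr 1; ext z
    simp [mul_assoc]
  one_mul μ := by
    ext f
    change μ (leftTranslate f 1) = μ f
    congr 1; ext x
    rw [leftTranslate_apply, one_mul]
  mul_one μ := by
    ext f
    change μ _ = μ f
    congr 1; ext x
    change f (x * 1) = f x
    rw [mul_one]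

theorem mul_apply (μ ν : Mean G) (f : RUCB G) : (μ * ν) f = μ (ν.convOp f) := rfl

theorem one_apply (f : RUCB G) : (1 : Mean G) f = f 1 := rfl

/-- The embedding `ι_{H,G} : M(H) → M(G)`, `ι_{H,G}(μ)(f) = μ(f|_H)`, through which means on a
subgroup are regarded as means on the group. -/
def induce (H : Subgroup G) (μ : Mean H) : Mean G where
  toFun f := μ (restrict H f)
  map_add' f g := map_add μ (restrict H f) (restrict H g)
  map_smul' c f := map_smul μ c (restrict H f)
  map_nonneg' _ hf := μ.map_nonneg fun x => hf x
  map_one' := μ.map_one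

@[simp] theorem induce_apply (H : Subgroup G) (μ : Mean H) (f : RUCB G) :
    μ.induce H f = μ (restrict H f) := rfl

/-- `μ(f ∘ λ_g) = μ(f)` for all `f ∈ RUCB(G)` and `g ∈ G`. -/
def IsLeftInvariant (μ : Mean G) : Prop :=
  ∀ (f : RUCB G) (g : G), μ (leftTranslate f g) = μ f

end Mean

/-- A topological group is amenable if it admits a left-invariant mean. -/
def IsAmenable (G : Type*) [Group G] [TopologicalSpace G] [IsTopologicalGroup G] : Prop :=
  ∃ μ : Mean G, μ.IsLeftInvariant

end Means

section SamuelCompactification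

/-- The Samuel compactification `S(G)`: the Gelfand space of `RUCB(G)`, i.e. the set of its unital
multiplicative linear functionals to `ℝ`, with the weak-* topology. -/
def Samuel (G : Type*) [Group G] [TopologicalSpace G] [IsTopologicalGroup G] : Type _ :=
  WeakDual.characterSpace ℝ (RUCB G)

variable {G : Type*} [Group G] [TopologicalSpace G] [IsTopologicalGroup G]

namespace Samuel

instance : TopologicalSpace (Samuel G) :=
  inferInstanceAs (TopologicalSpace (WeakDual.characterSpace ℝ (RUCB G)))

instance : T2Space (Samuel G) :=
  inferInstanceAs (T2Space (WeakDual.characterSpace ℝ (RUCB G)))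

theorem compactSpace_characterSpace (A : Type*) [NormedRing A] [NormedAlgebra ℝ A]
    [CompleteSpace A] : CompactSpace (WeakDual.characterSpace ℝ A) := inferInstance

instance : CompactSpace (Samuel G) := compactSpace_characterSpace (RUCB G)

instance : MeasurableSpace (Samuel G) := borel _

instance : BorelSpace (Samuel G) := ⟨rfl⟩

instance : FunLike (Samuel G) (RUCB G) ℝ :=
  inferInstanceAs (FunLike (WeakDual.characterSpace ℝ (RUCB G)) (RUCB G) ℝ)

instance : AlgHomClass (Samuel G) ℝ (RUCB G) ℝ :=
  inferInstanceAs (AlgHomClass (WeakDual.characterSpace ℝ (RUCB G)) ℝ (RUCB G) ℝ)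

theorem isInducing_coe :
    Topology.IsInducing (fun (ξ : Samuel G) (f : RUCB G) => ξ f) :=
  have h : Topology.IsInducing (fun (φ : WeakDual ℝ (RUCB G)) (f : RUCB G) => φ f) := ⟨rfl⟩
  h.comp Topology.IsInducing.subtypeVal

/-- The canonical map `η : G → S(G)`, `η(x)(f) = f(x)`. -/
def eta (x : G) : Samuel G :=
  (WeakDual.CharacterSpace.equivAlgHom (𝕜 := ℝ) (A := RUCB G)).symm
    { toFun := fun f : RUCB G => f x
      map_one' := rfl
      map_mul' := fun _ _ => rfl
      map_zero' := rfl
      map_add' := fun _ _ => rfl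
      commutes' := fun _ => rfl }

@[simp] theorem eta_apply (x : G) (f : RUCB G) : eta x f = f x := rfl

/-- For continuous `F : S(G) → ℝ`, the function `F ∘ η` belongs to `RUCB(G)`. -/
def pullback (F : C(Samuel G, ℝ)) : RUCB G :=
  ⟨BoundedContinuousFunction.ofNormedAddCommGroup (F ∘ eta)
    (F.continuous.comp (isInducing_coe.continuous_iff.2
      (continuous_pi fun f => f.1.continuous)))
    ‖F‖ (fun x => F.norm_coe_le_norm (eta x)), by
    let _ := IsTopologicalGroup.rightUniformSpace G
    let _ : UniformSpace (Samuel G) :=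
      (UniformSpace.comap (fun (ξ : Samuel G) (f : RUCB G) => ξ f) inferInstance).replaceTopology
        isInducing_coe.eq_induced
    have h : UniformContinuous fun (x : G) (f : RUCB G) => eta x f :=
      uniformContinuous_pi.2 fun f => f.2
    have hη : UniformContinuous (eta : G → Samuel G) :=
       Filter.tendsto_comap_iff.2 h
    exact (CompactSpace.uniformContinuous_of_continuous F.continuous).comp hη⟩

@[simp] theorem pullback_apply (F : C(Samuel G, ℝ)) (x : G) : pullback F x = F (eta x) := rfl

end Samuel

namespace Mean

open scoped CompactlySupported

/-- The positive linear form `F ↦ μ(F ∘ η)` on the continuous functions on `S(G)` (all of which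
are compactly supported, as `S(G)` is compact). -/
def toPositive (μ : Mean G) : C_c(Samuel G, ℝ) →ₚ[ℝ] ℝ :=
  PositiveLinearMap.mk₀
    { toFun := fun F => μ (Samuel.pullback F.toContinuousMap)
      map_add' := fun F F' =>
        map_add μ (Samuel.pullback F.toContinuousMap) (Samuel.pullback F'.toContinuousMap)
      map_smul' := fun c F => map_smul μ c (Samuel.pullback F.toContinuousMap) }
    fun _ hF => μ.map_nonneg fun x => hF (Samuel.eta x)

/-- The measure `μ̂` on `S(G)` that represents the mean `μ`. By `integral_hat` and
`eq_hat_of_integral` below it is the unique regular Borel probability measure on `S(G)` with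
`∫ F dμ̂ = μ(F ∘ η)` for every continuous `F : S(G) → ℝ`. -/
def hat (μ : Mean G) : MeasureTheory.Measure (Samuel G) :=
  RealRMK.rieszMeasure μ.toPositive

instance (μ : Mean G) : μ.hat.Regular :=
  inferInstanceAs (RealRMK.rieszMeasure μ.toPositive).Regular

theorem integral_hat (μ : Mean G) (F : C(Samuel G, ℝ)) :
    ∫ ξ, F ξ ∂μ.hat = μ (Samuel.pullback F) :=
  RealRMK.integral_rieszMeasure μ.toPositive
    (CompactlySupportedContinuousMap.continuousMapEquiv F)

instance (μ : Mean G) : MeasureTheory.IsProbabilityMeasure μ.hat := by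
  have : MeasureTheory.IsFiniteMeasure μ.hat :=
    inferInstanceAs (MeasureTheory.IsFiniteMeasure (RealRMK.rieszMeasure μ.toPositive))
  have h := μ.integral_hat 1
  have h1 : Samuel.pullback (1 : C(Samuel G, ℝ)) = 1 := by ext x; rfl
  rw [h1, μ.map_one] at h
  simp only [ContinuousMap.one_apply, MeasureTheory.integral_const, smul_eq_mul, mul_one] at h
  rw [MeasureTheory.measureReal_def, ENNReal.toReal_eq_one_iff] at h
  exact ⟨h⟩

theorem eq_hat_of_integral (μ : Mean G) (P : MeasureTheory.Measure (Samuel G)) [P.Regular]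
    (hP : ∀ F : C(Samuel G, ℝ), ∫ ξ, F ξ ∂P = μ (Samuel.pullback F)) : P = μ.hat :=
  MeasureTheory.Measure.ext_of_integral_eq_on_compactlySupported fun F =>
    (hP F.toContinuousMap).trans (μ.integral_hat F.toContinuousMap).symm

end Mean

end SamuelCompactification

section Length

/-- `Δ(G)`: the bounded, continuous, right-invariant pseudo-metrics `d` on `G`. Continuity means
that the topology generated by `d` is contained in the topology of `G`. -/
structure BddRightInvPseudoMetric (G : Type*) [Group G] [TopologicalSpace G] extends
    PseudoMetric G ℝ where
  bounded' : ∃ C, ∀ x y, toFun x y ≤ C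
  isOpen_ball' : ∀ x r, IsOpen {y | toFun x y < r}
  right_inv' : ∀ x y g, toFun (x * g) (y * g) = toFun x y

variable {G : Type*} [Group G] [TopologicalSpace G]

namespace BddRightInvPseudoMetric

instance : CoeFun (BddRightInvPseudoMetric G) (fun _ => G → G → ℝ) := ⟨fun d => d.toFun⟩

theorem nonneg (d : BddRightInvPseudoMetric G) (x y : G) : 0 ≤ d x y := by
  have h1 := d.triangle' x y x
  have h2 := d.refl' x
  have h3 := d.symm' x y
  linarith

/-- `d^g(x, y) = d(gx, gy)`. -/
def twist [IsTopologicalGroup G] (d : BddRightInvPseudoMetric G) (g : G) :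
    BddRightInvPseudoMetric G where
  toFun x y := d (g * x) (g * y)
  refl' x := d.refl' (g * x)
  symm' x y := d.symm' (g * x) (g * y)
  triangle' x y z := d.triangle' (g * x) (g * y) (g * z)
  bounded' := d.bounded'.imp fun _ h x y => h (g * x) (g * y)
  isOpen_ball' x r := (d.isOpen_ball' (g * x) r).preimage (continuous_const_mul g)
  right_inv' x y z := by
    rw [← mul_assoc, ← mul_assoc]
    exact d.right_inv' (g * x) (g * y) z

/-- The pseudo-metric `d_{G/H}(xH, yH) = inf_{h ∈ H} d(x, yh)` on the space of left cosets. -/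
def quot (d : BddRightInvPseudoMetric G) (H : Subgroup G) : G ⧸ H → G ⧸ H → ℝ :=
  Quotient.lift₂ (fun x y => ⨅ h : H, d x (y * h)) (by
    intro x y x' y' hx hy
    rw [← Quotient.eq_iff_equiv, Quotient.eq, QuotientGroup.leftRel_apply] at hx hy
    let e : H ≃ H := (Equiv.mulLeft (⟨_, hy⟩ : H)⁻¹).trans (Equiv.mulRight ⟨_, hx⟩)
    refine (Equiv.iInf_congr e fun h => ?_)
    have h2 := d.right_inv' x (y * h) (x⁻¹ * x')
    simpa [e, mul_assoc] using h2)

theorem quot_mk (d : BddRightInvPseudoMetric G) (H : Subgroup G) (x y : G) :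
    d.quot H (x : G ⧸ H) (y : G ⧸ H) = ⨅ h : H, d x (y * h) := rfl

/-- `diam(A, ρ) ∈ [0, ∞]`, for a real-valued distance function `ρ` and a set `A`. -/
def diam {X : Type*} (A : Set X) (ρ : X → X → ℝ) : ℝ≥0∞ :=
  ⨆ a ∈ A, ⨆ b ∈ A, ENNReal.ofReal (ρ a b)

/-- `K/H` as a subset of the space `G/H` of left cosets, where `H ≤ K ≤ G`. -/
def cosets (K H : Subgroup G) : Set (G ⧸ H) := (fun x : G => (x : G ⧸ H)) '' K

/-- `ℓ(G₀, …, Gₙ; d) = (∑_{i < n} (sup_{g ∈ G} diam(G_{i+1}/G_i, d^g_{G/G_i}))²)^{1/2}`. -/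
def length [IsTopologicalGroup G] (d : BddRightInvPseudoMetric G) {n : ℕ}
    (H : Fin (n + 1) → Subgroup G) : ℝ≥0∞ :=
  (∑ i : Fin n, (⨆ g : G,
    diam (cosets (H i.succ) (H i.castSucc)) ((d.twist g).quot (H i.castSucc))) ^ 2) ^ (1 / 2 : ℝ)

/-- Every `f ∈ Lip₁(G, d)` belongs to `RUCB(G)`. -/
def lip [IsTopologicalGroup G] (d : BddRightInvPseudoMetric G) (f : G → ℝ)
    (hf : ∀ x y, |f x - f y| ≤ d x y) : RUCB G :=
  RUCB.mk f
    (by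
      obtain ⟨C, hC⟩ := d.bounded'
      refine ⟨C + |f 1|, fun x => ?_⟩
      have h1 := abs_sub_abs_le_abs_sub (f x) (f 1)
      have h2 := hf x 1
      have h3 := hC x 1
      linarith)
    (by
      intro ε hε
      refine ⟨{y | d 1 y < ε}, (d.isOpen_ball' 1 ε).mem_nhds ?_, fun x y hxy => ?_⟩
      · change d 1 1 < ε
        rw [d.refl']; exact hε
      · refine (hf x y).trans_lt ?_
        have h := d.right_inv' 1 (y * x⁻¹) x
        rw [one_mul, inv_mul_cancel_right] at h
        rw [h]; exact hxy)

@[simp] theorem lip_apply [IsTopologicalGroup G] (d : BddRightInvPseudoMetric G) (f : G → ℝ)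
    (hf) (x : G) : d.lip f hf x = f x := rfl

end BddRightInvPseudoMetric

end Length

end

end InvariantMeans

/-!
The proof is the bounded-difference martingale method, run inside `RUCB(G)` with means in place of
conditional expectations.

Let `πₖ = νₖ ⋯ ν₁` be the partial products and `fₖ(g) = πₖ(f ∘ λ_g)`, so that `f₀ = f` and
`fₖ₊₁(g)` is the `νₖ₊₁`-average of `x ↦ fₖ(g x)` over `Gₖ₊₁`. Invariance of `νₖ` makes `fₖ`
right `Gₖ`-invariant (`Mean.convOp_induce_mul_right`), and right invariance of `d` makes every `fₖ`
again `1`-Lipschitz for `d` (`BddRightInvPseudoMetric.abs_convOp_lip_sub_le`). The two facts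
together bound the oscillation of `fₖ` on each coset `g Gₖ₊₁` by
`aₖ = sup_g diam(Gₖ₊₁/Gₖ, d^g_{G/Gₖ})` (`IsSubgaussianMean.abs_convOp_sub_le`). Hoeffding's
convexity argument for means (`Mean.exp_moment_le`) then yields
`πₖ(exp(t f) ∘ λ_g) ≤ exp(t fₖ(g) + (a₀² + ⋯ + aₖ₋₁²) t² / 2)` by induction on `k`
(`IsSubgaussianMean.induce_mul`).

For `k = n` and `g = 1` this says that `ξ ↦ ξ(f) - μ(f)` has a sub-Gaussian moment generating
function with variance proxy `ℓ²` under `μ̂`, and the Chernoff bound gives the tail estimate. When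
`ℓ = 0` the sub-Gaussian variable vanishes almost everywhere.
-/

namespace InvariantMeans

open MeasureTheory ProbabilityTheory

noncomputable section

/-! ### Exponentials in `RUCB(G)` and a Hoeffding estimate for means -/

section Hoeffding

variable {G : Type*} [Group G] [TopologicalSpace G] [IsTopologicalGroup G]

theorem Samuel.continuous_apply (F : RUCB G) : Continuous fun ξ : Samuel G => ξ F :=
  (_root_.continuous_apply F).comp Samuel.isInducing_coe.continuous

/-- The continuous function `ξ ↦ exp(t ξ(F))` on the Samuel compactification. -/
def Samuel.expMul (t : ℝ) (F : RUCB G) : C(Samuel G, ℝ) where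
  toFun ξ := Real.exp (t * ξ F)
  continuous_toFun := Real.continuous_exp.comp (continuous_const.mul (Samuel.continuous_apply F))

/-- The function `x ↦ exp(t F(x))` as an element of `RUCB(G)`. It is obtained by restricting
`ξ ↦ exp(t ξ(F))` from the Samuel compactification, which makes its uniform continuity automatic. -/
def RUCB.expMul (t : ℝ) (F : RUCB G) : RUCB G := Samuel.pullback (Samuel.expMul t F)

@[simp] theorem RUCB.expMul_apply (t : ℝ) (F : RUCB G) (x : G) :
    RUCB.expMul t F x = Real.exp (t * F x) := rfl

namespace Mean

theorem apply_sub (m : Mean G) (u v : RUCB G) : m (u - v) = m u - m v :=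
  m.toLinearMap.map_sub u v

theorem map_smul_one (m : Mean G) (c : ℝ) : m (c • (1 : RUCB G)) = c := by
  rw [map_smul, m.map_one, smul_eq_mul, mul_one]

theorem abs_sub_le_of_oscillation (m : Mean G) {u : RUCB G} {a : ℝ}
    (h : ∀ x y, |u x - u y| ≤ a) (x : G) : |u x - m u| ≤ a := by
  have h1 : m (u x • (1 : RUCB G) - u) = u x - m u := by
    rw [m.apply_sub, m.map_smul_one]
  rw [← h1]
  refine m.abs_le fun y => ?_
  have h2 : (u x • (1 : RUCB G) - u) y = u x - u y := by
    change u x * 1 - u y = _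
    rw [mul_one]
  rw [h2]
  exact h x y

/-- Hoeffding's estimate for means: if `u` has oscillation at most `a` and `v ≤ C exp(t u)`
pointwise, then `m(v) ≤ C exp(t m(u) + a² t² / 2)`. -/
theorem exp_moment_le (m : Mean G) {u v : RUCB G} {a t C : ℝ}
    (h : ∀ x y, |u x - u y| ≤ a) (hC : 0 ≤ C) (hv : ∀ x, v x ≤ C * Real.exp (t * u x)) :
    m v ≤ C * Real.exp (t * m u + a ^ 2 * t ^ 2 / 2) := by
  have ha : 0 ≤ a := (abs_nonneg _).trans (h 1 1)
  -- The chord of `s ↦ exp(t s)` over `[-a, a]`, evaluated at `u - m(u)`; its linear part has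
  -- mean zero. For `a = 0` the division by zero is harmless, since then `u - m(u) = 0`.
  let w : RUCB G := (C * Real.exp (t * m u)) •
    (Real.cosh (a * t) • (1 : RUCB G) + (Real.sinh (a * t) / a) • (u - m u • (1 : RUCB G)))
  have hw (x : G) : w x = C * Real.exp (t * m u) *
      (Real.cosh (a * t) + (u x - m u) / a * Real.sinh (a * t)) := by
    change C * Real.exp (t * m u) *
      (Real.cosh (a * t) * 1 + Real.sinh (a * t) / a * (u x - m u * 1)) = _
    ring
  have hmw : m w = C * Real.exp (t * m u) * Real.cosh (a * t) := by
    have h0 : m (u - m u • (1 : RUCB G)) = 0 := by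
      rw [m.apply_sub, m.map_smul_one, sub_self]
    rw [map_smul, map_add, map_smul_one, map_smul, h0]
    simp
  have hvw : m v ≤ m w := m.mono fun x => by
    have hx := m.abs_sub_le_of_oscillation h x
    have hle : |(u x - m u) / a| ≤ 1 := by
      rw [abs_div, abs_of_nonneg ha]
      exact div_le_one_of_le₀ hx ha
    have hexp := Real.exp_mul_le_cosh_add_mul_sinh hle (a * t)
    have hcancel : (u x - m u) / a * (a * t) = t * u x - t * m u := by
      rcases ha.eq_or_lt with h0 | h0
      · rw [← h0] at hx ⊢
        have : u x = m u := sub_eq_zero.1 (abs_nonpos_iff.1 hx)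
        simp [this]
      · field_simp
    rw [hcancel] at hexp
    calc v x ≤ C * Real.exp (t * u x) := hv x
      _ = C * Real.exp (t * m u) * Real.exp (t * u x - t * m u) := by
          rw [mul_assoc, ← Real.exp_add]; ring_nf
      _ ≤ w x := by rw [hw]; gcongr
  calc m v ≤ C * Real.exp (t * m u) * Real.cosh (a * t) := hvw.trans_eq hmw
    _ ≤ C * Real.exp (t * m u) * Real.exp ((a * t) ^ 2 / 2) := by
        gcongr; exact Real.cosh_le_exp_half_sq _
    _ = _ := by rw [mul_assoc, ← Real.exp_add]; ring_nf

theorem convOp_mul (μ ν : Mean G) (F : RUCB G) : (μ * ν).convOp F = μ.convOp (ν.convOp F) := by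
  ext x
  change μ _ = μ _
  congr 1; ext y
  change ν _ = ν _
  congr 1; ext z
  simp [mul_assoc]

theorem convOp_one (F : RUCB G) : (1 : Mean G).convOp F = F := by
  ext x
  change F (x * 1) = F x
  rw [mul_one]

theorem apply_eq_convOp_one (μ : Mean G) (F : RUCB G) : μ F = μ.convOp F 1 := by
  rw [convOp_apply]
  congr 1; ext x
  simp

theorem convOp_induce (L : Subgroup G) (ν : Mean L) (F : RUCB G) (g : G) :
    (ν.induce L).convOp F g = ν (restrict L (leftTranslate F g)) := rfl

theorem convOp_induce_mul_right {L : Subgroup G} {ν : Mean L} (hν : ν.IsLeftInvariant)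
    (F : RUCB G) (g : G) {h : G} (hh : h ∈ L) :
    (ν.induce L).convOp F (g * h) = (ν.induce L).convOp F g := by
  rw [convOp_induce, convOp_induce, ← hν (restrict L (leftTranslate F g)) ⟨h, hh⟩]
  congr 1; ext x
  simp [mul_assoc]

end Mean

end Hoeffding

/-! ### Diameters of the fibres -/

namespace BddRightInvPseudoMetric

variable {G : Type*} [Group G] [TopologicalSpace G] [IsTopologicalGroup G]

/-- `sup_{g ∈ G} diam(L/K, d^g_{G/K})`, the contribution of the step from `K` to `L` to the
length of a chain of subgroups. -/
def stepDiam (d : BddRightInvPseudoMetric G) (L K : Subgroup G) : ℝ≥0∞ :=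
  ⨆ g : G, diam (cosets L K) ((d.twist g).quot K)

theorem stepDiam_ne_top (d : BddRightInvPseudoMetric G) (L K : Subgroup G) :
    d.stepDiam L K ≠ ∞ := by
  obtain ⟨C, hC⟩ := d.bounded'
  refine ne_top_of_le_ne_top (ENNReal.ofReal_ne_top (r := C)) ?_
  refine iSup_le fun g => iSup₂_le ?_
  rintro _ ⟨x, -, rfl⟩
  refine iSup₂_le ?_
  rintro _ ⟨y, -, rfl⟩
  refine ENNReal.ofReal_le_ofReal ?_
  rw [quot_mk]
  exact (ciInf_le ⟨0, by rintro _ ⟨h, rfl⟩; exact nonneg _ _ _⟩ 1).trans (hC _ _)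

theorem iInf_le_stepDiam (d : BddRightInvPseudoMetric G) {L : Subgroup G} (K : Subgroup G)
    (g : G) {x y : G} (hx : x ∈ L) (hy : y ∈ L) :
    ⨅ h : K, d (g * x) (g * (y * h)) ≤ (d.stepDiam L K).toReal := by
  rw [← ENNReal.ofReal_le_iff_le_toReal (d.stepDiam_ne_top L K)]
  refine le_trans ?_ (le_iSup _ g)
  exact (le_iSup₂_of_le (f := fun b (_ : b ∈ cosets L K) =>
    ENNReal.ofReal ((d.twist g).quot K (x : G ⧸ K) b)) (y : G ⧸ K) ⟨y, hy, rfl⟩ le_rfl).trans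
    (le_iSup₂_of_le (f := fun a (_ : a ∈ cosets L K) => ⨆ b ∈ cosets L K,
      ENNReal.ofReal ((d.twist g).quot K a b)) (x : G ⧸ K) ⟨x, hx, rfl⟩ le_rfl)

theorem length_sq (d : BddRightInvPseudoMetric G) {n : ℕ} (H : Fin (n + 1) → Subgroup G) :
    d.length H ^ 2 = ∑ i : Fin n, d.stepDiam (H i.succ) (H i.castSucc) ^ 2 := by
  unfold length stepDiam
  rw [← ENNReal.rpow_natCast, ← ENNReal.rpow_mul]
  norm_num

theorem abs_convOp_lip_sub_le (d : BddRightInvPseudoMetric G) (π : Mean G) {f : G → ℝ}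
    (hf : ∀ x y, |f x - f y| ≤ d x y) (x y : G) :
    |π.convOp (d.lip f hf) x - π.convOp (d.lip f hf) y| ≤ d x y := by
  rw [Mean.convOp_apply, Mean.convOp_apply, ← map_sub]
  refine π.abs_le fun z => ?_
  exact (hf (x * z) (y * z)).trans_eq (d.right_inv' x y z)

end BddRightInvPseudoMetric

/-! ### Sub-Gaussian estimates along the chain -/

section Chain

variable {G : Type*} [Group G] [TopologicalSpace G] [IsTopologicalGroup G]

/-- The induction hypothesis carried along the chain: averaging with `π` yields right
`K`-invariant functions, and for every `1`-Lipschitz `f` the left translates `f ∘ λ_g` are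
sub-Gaussian with variance proxy `c` under `π`, uniformly in `g`. -/
structure IsSubgaussianMean (d : BddRightInvPseudoMetric G) (K : Subgroup G) (c : ℝ)
    (π : Mean G) : Prop where
  convOp_mul_right : ∀ (F : RUCB G) (g h : G), h ∈ K → π.convOp F (g * h) = π.convOp F g
  exp_moment_le : ∀ (f : G → ℝ) (hf : ∀ x y, |f x - f y| ≤ d x y) (t : ℝ) (g : G),
    π.convOp (RUCB.expMul t (d.lip f hf)) g ≤
      Real.exp (t * π.convOp (d.lip f hf) g + c * t ^ 2 / 2)

namespace IsSubgaussianMean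

variable {d : BddRightInvPseudoMetric G} {K : Subgroup G} {c : ℝ} {π : Mean G}

theorem one (d : BddRightInvPseudoMetric G) : IsSubgaussianMean d ⊥ 0 (1 : Mean G) where
  convOp_mul_right F g h hh := by rw [Subgroup.mem_bot.1 hh, mul_one]
  exp_moment_le f hf t g := by simp [Mean.convOp_one]

/-- On a coset of `L` the averaged function oscillates by at most the diameter of `L/K`: it is
`1`-Lipschitz, and it does not change when one of the two arguments moves in its coset of `K`. -/
theorem abs_convOp_sub_le (hπ : IsSubgaussianMean d K c π) {L : Subgroup G} {f : G → ℝ}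
    (hf : ∀ x y, |f x - f y| ≤ d x y) (g : G) {x y : G} (hx : x ∈ L) (hy : y ∈ L) :
    |π.convOp (d.lip f hf) (g * x) - π.convOp (d.lip f hf) (g * y)| ≤
      (d.stepDiam L K).toReal := by
  refine le_trans (le_ciInf fun h : K => ?_) (d.iInf_le_stepDiam K g hx hy)
  rw [← hπ.convOp_mul_right _ (g * y) h h.2, mul_assoc]
  exact d.abs_convOp_lip_sub_le π hf _ _

theorem induce_mul (hπ : IsSubgaussianMean d K c π) {L : Subgroup G} {ν : Mean L}
    (hν : ν.IsLeftInvariant) :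
    IsSubgaussianMean d L (c + (d.stepDiam L K).toReal ^ 2) (ν.induce L * π) where
  convOp_mul_right F g h hh := by
    rw [Mean.convOp_mul, Mean.convOp_induce_mul_right hν _ g hh]
  exp_moment_le f hf t g := by
    rw [Mean.convOp_mul, Mean.convOp_mul, Mean.convOp_induce, Mean.convOp_induce]
    refine (ν.exp_moment_le (C := Real.exp (c * t ^ 2 / 2)) (t := t)
      (u := restrict L (leftTranslate (π.convOp (d.lip f hf)) g))
      (fun x y => hπ.abs_convOp_sub_le hf g x.2 y.2) (Real.exp_nonneg _)
      fun x => ?_).trans_eq ?_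
    · rw [← Real.exp_add, add_comm]
      exact hπ.exp_moment_le f hf t (g * x)
    · rw [← Real.exp_add]
      ring_nf

theorem partial_prod {n : ℕ} {H : Fin (n + 1) → Subgroup G} (hbot : H 0 = ⊥)
    {ν : (i : Fin n) → Mean (H i.succ)} (hν : ∀ i, (ν i).IsLeftInvariant)
    (d : BddRightInvPseudoMetric G) (k : ℕ) (hk : k < n + 1) :
    IsSubgaussianMean d (H ⟨k, hk⟩)
      (∑ i : Fin k, (d.stepDiam (H ⟨i + 1, by lia⟩) (H ⟨i, by lia⟩)).toReal ^ 2)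
      ((List.ofFn fun i => (ν i).induce (H i.succ)).take k).reverse.prod := by
  induction k with
  | zero => simpa [hbot] using one d
  | succ k ih =>
    have hkn : k < n := by lia
    have hstep := (ih (by lia)).induce_mul (hν ⟨k, hkn⟩)
    rw [List.take_add_one, List.getElem?_eq_getElem (by simpa using hkn), Option.toList_some,
      List.reverse_append, List.reverse_singleton, List.singleton_append, List.prod_cons,
      List.getElem_ofFn, Fin.sum_univ_castSucc]
    exact hstep

end IsSubgaussianMean

end Chain

/-! ### Tail bounds on the Samuel compactification -/

section Tail

/-- Two-sided Chernoff bound with values in `[0, ∞]`. A vanishing variance proxy is allowed, in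
which case the quotient is `∞` and the bound is `0`. -/
theorem measure_le_abs_le_of_hasSubgaussianMGF {Ω : Type*} [MeasurableSpace Ω] {P : Measure Ω}
    [IsFiniteMeasure P] {X : Ω → ℝ} {c : NNReal} (hX : HasSubgaussianMGF X c P) {ε : ℝ}
    (hε : 0 < ε) :
    P {ω | ε ≤ |X ω|} ≤
      2 * EReal.exp (-((ENNReal.ofReal (ε ^ 2) / (2 * (c : ℝ≥0∞)) : ℝ≥0∞) : EReal)) := by
  rcases eq_or_ne c 0 with rfl | hc
  · have h0 : P {ω | ε ≤ |X ω|} = 0 := by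
      refine measure_eq_zero_iff_ae_notMem.2 ?_
      filter_upwards [hX.ae_eq_zero_of_hasSubgaussianMGF_zero] with ω h
      simpa [h] using hε
    rw [h0]
    exact bot_le
  · have hc' : (0 : ℝ) < 2 * c := by positivity
    have hquot : ENNReal.ofReal (ε ^ 2) / (2 * (c : ℝ≥0∞)) = ENNReal.ofReal (ε ^ 2 / (2 * c)) := by
      rw [ENNReal.ofReal_div_of_pos hc', ENNReal.ofReal_mul zero_le_two, ENNReal.ofReal_ofNat,
        ENNReal.ofReal_coe_nnreal]
    have hexp : EReal.exp (-((ENNReal.ofReal (ε ^ 2) / (2 * (c : ℝ≥0∞)) : ℝ≥0∞) : EReal)) =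
        ENNReal.ofReal (Real.exp (-ε ^ 2 / (2 * c))) := by
      rw [hquot, EReal.coe_ennreal_ofReal, max_eq_left (by positivity), ← EReal.coe_neg,
        EReal.exp_coe, neg_div]
    have htail {Y : Ω → ℝ} (hY : HasSubgaussianMGF Y c P) :
        P {ω | ε ≤ Y ω} ≤ ENNReal.ofReal (Real.exp (-ε ^ 2 / (2 * c))) := by
      rw [← ofReal_measureReal]
      exact ENNReal.ofReal_le_ofReal (hY.measure_ge_le hε.le)
    have hsub : {ω | ε ≤ |X ω|} ⊆ {ω | ε ≤ X ω} ∪ {ω | ε ≤ (-X) ω} := fun ω hω =>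
      le_abs.1 (show ε ≤ |X ω| from hω)
    rw [hexp, two_mul]
    exact (measure_mono hsub).trans ((measure_union_le _ _).trans (add_le_add (htail hX)
      (htail hX.neg)))

variable {G : Type*} [Group G] [TopologicalSpace G] [IsTopologicalGroup G]

theorem Mean.hasSubgaussianMGF_hat (μ : Mean G) (F : RUCB G) (c : NNReal)
    (h : ∀ t : ℝ, μ (RUCB.expMul t F) ≤ Real.exp (t * μ F + c * t ^ 2 / 2)) :
    HasSubgaussianMGF (fun ξ : Samuel G => ξ F - μ F) c μ.hat := by
  have hrw (t : ℝ) (ξ : Samuel G) :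
      Real.exp (t * (ξ F - μ F)) = Real.exp (-(t * μ F)) * Samuel.expMul t F ξ := by
    change _ = _ * Real.exp (t * ξ F)
    rw [← Real.exp_add]
    ring_nf
  refine ⟨fun t => ?_, fun t => ?_⟩
  · simp_rw [hrw]
    exact ((Samuel.expMul t F).continuous.integrable_of_hasCompactSupport
      (HasCompactSupport.of_compactSpace _)).const_mul _
  · have hm : mgf (fun ξ : Samuel G => ξ F - μ F) μ.hat t =
        Real.exp (-(t * μ F)) * μ (RUCB.expMul t F) := by
      simp_rw [mgf, hrw]
      rw [integral_const_mul, μ.integral_hat]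
      rfl
    rw [hm]
    calc Real.exp (-(t * μ F)) * μ (RUCB.expMul t F)
        ≤ Real.exp (-(t * μ F)) * Real.exp (t * μ F + c * t ^ 2 / 2) := by gcongr; exact h t
      _ = Real.exp (c * t ^ 2 / 2) := by rw [← Real.exp_add]; ring_nf

end Tail

end

end InvariantMeans

open InvariantMeans in
/-- Concentration inequality for convolution products of invariant means along a chain of amenable
subgroups. The quotient is taken in `[0, ∞]` and the exponential is that of the extended reals, so
that for `ℓ = 0` the right-hand side is `2 * exp(-∞) = 0`. -/
theorem mainTheorem1 {G : Type*} [Group G] [TopologicalSpace G] [IsTopologicalGroup G]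
    (n : ℕ) (H : Fin (n + 1) → Subgroup G) (hmono : Monotone H)
    (hbot : H 0 = ⊥) (htop : H (Fin.last n) = ⊤) (hamen : ∀ i, IsAmenable (H i))
    (ν : (i : Fin n) → Mean (H i.succ)) (hν : ∀ i, (ν i).IsLeftInvariant)
    (μ : Mean G) (hμ : μ = (List.ofFn fun i => (ν i).induce (H i.succ)).reverse.prod)
    (d : BddRightInvPseudoMetric G) (f : G → ℝ) (hf : ∀ x y, |f x - f y| ≤ d x y)
    (ε : ℝ) (hε : 0 < ε) :
    μ.hat {ξ : Samuel G | ε ≤ |ξ (d.lip f hf) - μ (d.lip f hf)|} ≤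
      2 * EReal.exp (-((ENNReal.ofReal (ε ^ 2) / (2 * d.length H ^ 2) : ENNReal) : EReal)) := by
  have hμ' : IsSubgaussianMean d (H (Fin.last n))
      (∑ i : Fin n, (d.stepDiam (H i.succ) (H i.castSucc)).toReal ^ 2) μ := by
    have h := IsSubgaussianMean.partial_prod hbot hν d n n.lt_succ_self
    rw [List.take_of_length_le (by simp), ← hμ] at h
    exact h
  let c : NNReal := ∑ i : Fin n, (d.stepDiam (H i.succ) (H i.castSucc)).toNNReal ^ 2
  have hlen : d.length H ^ 2 = (c : ENNReal) := by
    rw [d.length_sq, ENNReal.ofNNReal_finsetSum]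
    refine Finset.sum_congr rfl fun i _ => ?_
    rw [ENNReal.coe_pow, ENNReal.coe_toNNReal (d.stepDiam_ne_top _ _)]
  rw [hlen]
  refine measure_le_abs_le_of_hasSubgaussianMGF (μ.hasSubgaussianMGF_hat _ c fun t => ?_) hε
  have h := hμ'.exp_moment_le f hf t 1
  rw [← Mean.apply_eq_convOp_one, ← Mean.apply_eq_convOp_one] at h
  refine h.trans_eq ?_
  simp [c, ENNReal.toReal]
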